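/- For $n\ge 1$, $m\ge 2$ let $S(n,m)$ be the (generalized and extended) Sierpinski graph: its vertex set is $\{0,1,\dots,m-1\}^n$, and $u,v$ are adjacent iff there is $h\in\{1,\dots,n\}$ such that $u_i=v_i$ for $i<h$, $u_h\neq v_h$, and $u_j=v_h$, $v_j=u_h$ for $j>h$. Its corner vertices are $i^n=(i,\dots,i)$, $0\le i<m$. Partition $\{0,\dots,m-1\}$ arbitrarily into three (possibly empty) classes $I,J,K$. For each $i\in I\cup K$ attach an external edge $\{v_i,i^n\}$ with a new vertex $v_i$; the corners $j^n$ with $j\in J$ carry no external edge. For a set $S\subseteq\{0,\dots,m-1\}^n$ let $\Theta(S)$ be the set of edges (internal and external) of the resulting graph with exactly one end in $S\cup\{v_i : i\in I\}$; that is, $v_i$ is regarded as a member of $S$ if $i\in I$ and as a member of the complement of $S$ if $i\in K$, but the $v_i$ are not counted in $|S|$. Then, for every such choice of $n,m,I,J,K$, the graph $S(n,m)$ with external edges has nested solutions of the edge-isoperimetric problem: there is a total order on $\{0,\dots,m-1\}^n$ such that for every $\ell$ with $0\le\ell\le m^n$ the set $S_\ell$ of the first $\ell$ vertices satisfies $|\Theta(S_\ell)|=\min\{|\Theta(S)|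 : S\subseteq\{0,\dots,m-1\}^n,\ |S|=\ell\}$. -/

import Mathlib

/-- The edge-boundary `Θ(S)`: the edges `{v, w}` of `G` with `v ∈ S` and `w ∉ S`. -/
def edgeBoundary {V : Type*} (G : SimpleGraph V) (S : Set V) : Set (Sym2 V) :=
  {e | e ∈ G.edgeSet ∧ ∃ v w : V, e = s(v, w) ∧ v ∈ S ∧ w ∉ S}

/-- The generalized and extended Sierpinski graph `S(n,m)` on `{0, …, m-1}^n`. -/
def sierpinskiGraph (n m : ℕ) : SimpleGraph (Fin n → Fin m) where
  Adj u v := ∃ h : Fin n, (∀ i, i < h → u i = v i) ∧ u h ≠ v h ∧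
    ∀ j, h < j → u j = v h ∧ v j = u h
  symm := ⟨fun _ _ ⟨h, h1, h2, h3⟩ =>
    ⟨h, fun i hi => (h1 i hi).symm, h2.symm, fun j hj => ⟨(h3 j hj).2, (h3 j hj).1⟩⟩⟩
  loopless := ⟨fun _ ⟨_, _, h2, _⟩ => h2 rfl⟩

/-- The corner vertex `i^n = (i, i, …, i)`. -/
def corner (n : ℕ) {m : ℕ} (i : Fin m) : Fin n → Fin m := fun _ => i

/-- The three possible decorations of a corner:
`I`: an exterior edge whose exterior end counts as a member of every set `S`;
`J`: no exterior edge;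
`K`: an exterior edge whose exterior end counts as a member of the complement of every `S`. -/
inductive CornerClass
  | I
  | J
  | K

/-- The exterior vertices `v_i`, one for each corner that carries an exterior edge. -/
abbrev ExteriorVertex {m : ℕ} (c : Fin m → CornerClass) : Type :=
  {i : Fin m // c i ≠ CornerClass.J}

/-- The decorated Sierpinski graph: `S(n,m)`, together with, for every corner `i^n` of class
`I` or `K`, a new vertex `v_i` joined to `i^n` only. -/
def decoratedSierpinskiGraph (n : ℕ) {m : ℕ} (c : Fin m → CornerClass) :
    SimpleGraph ((Fin n → Fin m) ⊕ ExteriorVertex c) where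
  Adj
    | Sum.inl u, Sum.inl v => (sierpinskiGraph n m).Adj u v
    | Sum.inl u, Sum.inr i => u = corner n i.1
    | Sum.inr i, Sum.inl u => u = corner n i.1
    | Sum.inr _, Sum.inr _ => False
  symm := ⟨by
    rintro (u | i) (v | j) h
    · exact SimpleGraph.Adj.symm h
    · exact h
    · exact h
    · exact h⟩
  loopless := ⟨by
    rintro (u | i) h
    · exact SimpleGraph.irrefl _ h
    · exact h⟩

/-- A set `S` of vertices of `S(n,m)` together with the exterior vertices that count as members
of it, namely those at the corners of class `I`. -/
def withExterior (n : ℕ) {m : ℕ} (c : Fin m → CornerClass) (S : Finset (Fin n → Fin m)) :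
    Set ((Fin n → Fin m) ⊕ ExteriorVertex c) :=
  {x | (∃ u ∈ S, x = Sum.inl u) ∨ ∃ i : ExteriorVertex c, c i.1 = CornerClass.I ∧ x = Sum.inr i}

/-- The size of the edge-boundary of `S ⊆ {0, …, m-1}^n` in the decorated Sierpinski graph. -/
noncomputable def decoratedBoundarySize (n : ℕ) {m : ℕ} (c : Fin m → CornerClass)
    (S : Finset (Fin n → Fin m)) : ℕ :=
  (edgeBoundary (decoratedSierpinskiGraph n c) (withExterior n c S)).ncard

/-- `S` has `ℓ` elements and minimizes `θ` among all sets of `ℓ` vertices. -/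
def IsEIPSolution {V : Type*} (θ : Finset V → ℕ) (ℓ : ℕ) (S : Finset V) : Prop :=
  S.card = ℓ ∧ ∀ T : Finset V, T.card = ℓ → θ S ≤ θ T

/-- The problem of minimizing `θ` has nested solutions: for some total order (numbering) of the
vertices, the initial segment of every length `ℓ`, `0 ≤ ℓ ≤ |V|`, is a solution. -/
def HasNestedSolutions {V : Type*} [Fintype V] (θ : Finset V → ℕ) : Prop :=
  ∃ num : Fin (Fintype.card V) ≃ V, ∀ ℓ : ℕ, ℓ ≤ Fintype.card V →
    IsEIPSolution θ ℓ
      ((Finset.univ.filter fun k : Fin (Fintype.card V) => (k : ℕ) < ℓ).map num.toEmbedding)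

/-!
Split `S(n+1,m)` into its `m` copies of `S(n,m)`, any two of which are joined by a single edge. The
claim is that filling the copies one after the other is optimal, which recursively gives the
lexicographic order, with the symbols sorted so that class `I` comes first, then `J`, then `K`.

**Reduction to classes `I` and `K`.** Twice the weight of a corner of class `J` is the sum of the
weights of a corner of class `I` and of one of class `K`. So twice the decorated boundary is, up to
a constant, the sum of the functional `boundaryExcess A` for `A = {c = I}` and for `A = {c ≠ K}`
(`two_mul_decoratedBoundarySize`), and one order of the vertices serves both. It remains to show
that `boundaryExcess A S` is at least `profile m n |A| |S|`, a number given by an explicit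
recursion, and that lexicographic segments attain this bound (`boundaryExcess_lexSegment`).

**Decoupling.** Given `S`, rank the copies by decreasing number of vertices of `S`. The edge between
two copies contributes `|x - y| ≥ x - y`, where `x, y ∈ {0, 1}` tell whether its ends are in `S` and
`x` belongs to the copy of lower rank. This is the contribution obtained when each copy regards the
copies of lower rank as contained in `S` and the others as disjoint from it, so the boundary is at
least a sum over the copies separately (`sum_boundaryExcess_le`), with equality for segments
(`sum_boundaryExcess_eq`). By induction each summand is at least a value of the profile.

**Merging.** What remains concerns the profile alone. The first fact is that changing the corner
`k` from class `K` to class `I` saves `2` once the corner `k` has been reached, at a time increasing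
in `k` (`profile_sub_profile_succ`); hence the corners of class `I` may be assumed to sit at the
fullest copies (`profile_le_sum`). The second is `profile_merge`: for thresholds `s ≤ t` and sizes
`y ≤ x`, two partially filled copies may be replaced by one holding `x + y` vertices and an empty
one, or, after passing to complements, by a full one and one holding the rest. Applied to the first
copy that is not full and the last one that is not empty, this leads to the distribution in which
the copies are filled one after the other (`profile_le_sum_shift`). In `profile_merge` itself, if
neither set reaches beyond its first copy the induction hypothesis applies directly; otherwise
both profiles are replaced by the smaller one of a single threshold, and the loss is paid for by the
quadratic growth of the boundary in the number of full copies.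
-/

/-! ### The isoperimetric profile -/

/-- Suppose that the corners numbered `0, …, k-1` of a Sierpinski graph are of class `I` and the
others of class `K`, and that its copies are filled one after the other. While the copy numbered
`i` is being filled, `shift k i` of its corners are of class `I`: those joined to the `i` full
copies, and its own exterior corner if `i < k`. -/
def shift (k i : ℕ) : ℕ := if i < k then i + 1 else i

theorem shift_le {m k i : ℕ} (hi : i < m) : shift k i ≤ m := by
  unfold shift; split <;> omega

theorem shift_le_of_le {m k i : ℕ} (hk : k ≤ m) (hi : i ≤ m) : shift k i ≤ m := by
  unfold shift; split <;> omega

theorem le_shift (k i : ℕ) : i ≤ shift k i := by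
  unfold shift; split <;> omega

theorem shift_mono {k i j : ℕ} (h : i ≤ j) : shift k i ≤ shift k j := by
  unfold shift; split <;> split <;> omega

/-- The least value of `|∂S| + #(corners of class K in S) - #(corners of class I in S)` over all
sets `S` of `x` vertices of `S(n,m)`, when `k` corners are of class `I` and `m - k` of class `K`.
It is defined by the recursion that filling the copies one after the other gives. -/
def profile (m : ℕ) : ℕ → ℕ → ℕ → ℤ
  | 0, k, x => if x = 0 then 0 else m - 2 * k
  | n + 1, k, x => ∑ i ∈ Finset.range (x / m ^ n), ((m : ℤ) - 2 * shift k i) +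
      profile m n (shift k (x / m ^ n)) (x % m ^ n)

theorem profile_zero_right (m n k : ℕ) : profile m n k 0 = 0 := by
  induction n generalizing k with
  | zero => simp [profile]
  | succ n ih => simp [profile, ih]

theorem sum_slope (m k a : ℕ) :
    ∑ i ∈ Finset.range a, ((m : ℤ) - 2 * shift k i) =
      a * (m + 1) - (a : ℤ) ^ 2 - 2 * min a k := by
  induction a with
  | zero => simp
  | succ a ih =>
    rw [Finset.sum_range_succ, ih]
    unfold shift
    split
    · rw [min_eq_left (by omega : a ≤ k), min_eq_left (by omega : a + 1 ≤ k)]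
      push_cast; ring
    · rw [min_eq_right (by omega : k ≤ a), min_eq_right (by omega : k ≤ a + 1)]
      push_cast; ring

theorem profile_full {m n k : ℕ} (hm : 0 < m) (hk : k ≤ m) :
    profile m n k (m ^ n) = m - 2 * k := by
  cases n with
  | zero => simp [profile]
  | succ n =>
    have hM : 0 < m ^ n := Nat.pow_pos hm
    have h1 : m ^ (n + 1) / m ^ n = m := by rw [pow_succ]; exact Nat.mul_div_cancel_left _ hM
    have h2 : m ^ (n + 1) % m ^ n = 0 := by rw [pow_succ]; exact Nat.mul_mod_right _ _
    rw [profile, h1, h2, profile_zero_right, sum_slope, min_eq_right hk]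
    ring

theorem profile_succ_of_lt {m n k a x : ℕ} (hx : x < m ^ n) :
    profile m (n + 1) k (a * m ^ n + x) =
      ∑ i ∈ Finset.range a, ((m : ℤ) - 2 * shift k i) + profile m n (shift k a) x := by
  have h1 : (a * m ^ n + x) / m ^ n = a := by
    rw [mul_comm, Nat.mul_add_div (by omega), Nat.div_eq_of_lt hx, add_zero]
  have h2 : (a * m ^ n + x) % m ^ n = x := by
    rw [mul_comm, Nat.mul_add_mod, Nat.mod_eq_of_lt hx]
  rw [profile, h1, h2]

/-- The recursion for `profile`, with a remainder that may also fill its copy. -/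
theorem profile_succ {m n k a x : ℕ} (hm : 0 < m) (ha : a < m) (hx : x ≤ m ^ n) :
    profile m (n + 1) k (a * m ^ n + x) =
      ∑ i ∈ Finset.range a, ((m : ℤ) - 2 * shift k i) + profile m n (shift k a) x := by
  rcases hx.lt_or_eq with h | rfl
  · exact profile_succ_of_lt h
  · have h0 : a * m ^ n + m ^ n = (a + 1) * m ^ n + 0 := by ring
    rw [h0, profile_succ_of_lt (Nat.pow_pos hm), profile_zero_right,
      profile_full hm (shift_le ha), Finset.sum_range_succ, add_zero]

/-- One plus the position of the corner `k^n` in the lexicographic order of the vertices. -/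
def cornerTime (m : ℕ) : ℕ → ℕ → ℕ
  | 0, _ => 1
  | n + 1, k => k * m ^ n + cornerTime m n k

theorem cornerTime_pos (m n k : ℕ) : 0 < cornerTime m n k := by
  induction n with
  | zero => simp [cornerTime]
  | succ n ih => simp only [cornerTime]; omega

theorem cornerTime_le {m n k : ℕ} (hk : k < m) : cornerTime m n k ≤ m ^ n := by
  induction n with
  | zero => simp [cornerTime]
  | succ n ih =>
    have : (k + 1) * m ^ n ≤ m * m ^ n := Nat.mul_le_mul_right _ hk
    simp only [cornerTime, pow_succ]
    nlinarith

theorem cornerTime_mono (m n : ℕ) : Monotone (cornerTime m n) := by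
  intro k l h
  induction n with
  | zero => simp [cornerTime]
  | succ n ih =>
    simp only [cornerTime]
    exact add_le_add (Nat.mul_le_mul_right _ h) ih

/-- Moving the corner `k` from class `K` to class `I` saves exactly two as soon as that corner
has been reached, and nothing before. -/
theorem profile_sub_profile_succ {m n k x : ℕ} (hm : 0 < m) (hk : k < m) :
    profile m n k x - profile m n (k + 1) x = if cornerTime m n k ≤ x then 2 else 0 := by
  induction n generalizing x with
  | zero =>
    rcases Nat.eq_zero_or_pos x with rfl | hx
    · simp [profile, cornerTime]
    · have h1 : x ≠ 0 := by omega
      have h2 : 1 ≤ x := hx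
      simp only [profile, cornerTime, h1, h2, if_true, if_false]
      push_cast; ring
  | succ n ih =>
    have hM : 0 < m ^ n := Nat.pow_pos hm
    have hdiv : m ^ n * (x / m ^ n) + x % m ^ n = x := Nat.div_add_mod x (m ^ n)
    have hmod := Nat.mod_lt x hM
    rw [show cornerTime m (n + 1) k = k * m ^ n + cornerTime m n k from rfl]
    simp only [profile]
    generalize x / m ^ n = a at *
    generalize x % m ^ n = y at *
    have ht := cornerTime_pos m n k
    have ht' := cornerTime_le (n := n) hk
    rw [sum_slope, sum_slope]
    rcases lt_trichotomy a k with h | h | h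
    · have h3 : (a + 1) * m ^ n ≤ k * m ^ n := Nat.mul_le_mul_right _ h
      have h4 : ¬ (k * m ^ n + cornerTime m n k ≤ x) := by nlinarith
      have h5 : shift k a = shift (k + 1) a := by
        unfold shift; split <;> split <;> omega
      rw [if_neg h4, h5, min_eq_left (by omega : a ≤ k), min_eq_left (by omega : a ≤ k + 1)]
      ring
    · have h5 : shift k a = k := by unfold shift; split <;> omega
      have h6 : shift (k + 1) a = k + 1 := by unfold shift; split <;> omega
      have h7 : (k * m ^ n + cornerTime m n k ≤ x) ↔ cornerTime m n k ≤ y := by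
        rw [← hdiv, h, mul_comm]; omega
      rw [h5, h6, min_eq_left (by omega : a ≤ k), min_eq_left (by omega : a ≤ k + 1)]
      simp only [h7]
      rw [← ih]
      ring
    · have h3 : (k + 1) * m ^ n ≤ a * m ^ n := Nat.mul_le_mul_right _ h
      have h4 : k * m ^ n + cornerTime m n k ≤ x := by nlinarith
      have h5 : shift k a = shift (k + 1) a := by
        unfold shift; split <;> split <;> omega
      rw [if_pos h4, h5, min_eq_right (by omega : k ≤ a), min_eq_right (by omega : k + 1 ≤ a)]
      push_cast; ring

theorem profile_anti {m n k l x : ℕ} (hm : 0 < m) (hkl : k ≤ l) (hl : l ≤ m) :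
    profile m n l x ≤ profile m n k x := by
  induction l, hkl using Nat.le_induction with
  | base => exact le_rfl
  | succ l hkl ih =>
    have h := profile_sub_profile_succ (n := n) (x := x) hm (k := l) (by omega)
    have h' := ih (by omega)
    split at h <;> linarith

/-- Passing to complements exchanges the classes `I` and `K`. -/
theorem profile_compl {m n k x : ℕ} (hm : 0 < m) (hk : k ≤ m) (hx : x ≤ m ^ n) :
    profile m n k (m ^ n - x) = profile m n (m - k) x + m - 2 * k := by
  induction n generalizing k x with
  | zero =>
    have : x = 0 ∨ x = 1 := by simp at hx; omega
    rcases this with rfl | rfl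
    · simp [profile]
    · simp [profile, Nat.cast_sub hk]; ring
  | succ n ih =>
    have hM : 0 < m ^ n := Nat.pow_pos hm
    rcases hx.lt_or_eq with hx | rfl
    · have hdiv : m ^ n * (x / m ^ n) + x % m ^ n = x := Nat.div_add_mod x (m ^ n)
      have hmod := Nat.mod_lt x hM
      have ha : x / m ^ n < m := by
        rw [Nat.div_lt_iff_lt_mul hM, mul_comm, ← pow_succ]; exact hx
      generalize x / m ^ n = a at *
      generalize x % m ^ n = y at *
      obtain ⟨b, rfl⟩ : ∃ b, m = a + b + 1 := ⟨m - a - 1, by omega⟩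
      have e1 : (a + b + 1) ^ (n + 1) - x = b * (a + b + 1) ^ n + ((a + b + 1) ^ n - y) := by
        rw [← hdiv, pow_succ]
        generalize (a + b + 1) ^ n = M at *
        have : M * (a + b + 1) = M * a + (b * M + M) := by ring
        omega
      rw [e1, ← hdiv, mul_comm _ a, profile_succ hm (by omega) (by omega),
        profile_succ hm (by omega) hmod.le, ih (shift_le (by omega)) hmod.le, sum_slope, sum_slope]
      have e2 : a + b + 1 - shift k b = shift (a + b + 1 - k) a := by
        unfold shift; split <;> split <;> omega
      have e3 : (shift k b : ℤ) = if b < k then (b : ℤ) + 1 else b := by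
        unfold shift; split <;> simp
      rw [e2, e3]
      split
      · rw [min_eq_left (by omega : b ≤ k), min_eq_right (by omega : a + b + 1 - k ≤ a),
          Nat.cast_sub hk]
        push_cast; ring
      · rw [min_eq_right (by omega : k ≤ b), min_eq_left (by omega : a ≤ a + b + 1 - k)]
        push_cast; ring
    · rw [Nat.sub_self, profile_zero_right, profile_full hm (by omega), Nat.cast_sub hk]
      ring

/-- If two partially filled copies, the fuller one coming first, may be merged whenever there is
room, then an overfull pair may be replaced by a full copy followed by the rest: pass to
complements. -/
theorem profile_merge_full_of_merge {m n : ℕ} (hm : 0 < m)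
    (H : ∀ {s t x y : ℕ}, s ≤ t → t ≤ m → y ≤ x → x + y ≤ m ^ n →
      profile m n s (x + y) ≤ profile m n s x + profile m n t y)
    {s t x y : ℕ} (hst : s ≤ t) (ht : t ≤ m) (hyx : y ≤ x) (hx : x ≤ m ^ n)
    (hxy : m ^ n ≤ x + y) :
    (m : ℤ) - 2 * s + profile m n t (x + y - m ^ n) ≤ profile m n s x + profile m n t y := by
  have h := H (s := m - t) (t := m - s) (x := m ^ n - y) (y := m ^ n - x)
    (by omega) (by omega) (by omega) (by omega)
  have h1 := profile_compl (n := n) (x := m ^ n - x) hm (hst.trans ht) (by omega)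
  have h2 := profile_compl (n := n) (x := m ^ n - y) hm ht (by omega)
  have h3 := profile_compl (n := n) (x := (m ^ n - y) + (m ^ n - x)) hm ht (by omega)
  rw [show m ^ n - (m ^ n - x) = x by omega] at h1
  rw [show m ^ n - (m ^ n - y) = y by omega] at h2
  rw [show m ^ n - ((m ^ n - y) + (m ^ n - x)) = x + y - m ^ n by omega] at h3
  linarith

/-- The arithmetic behind `profile_merge` when the remainders of `x = a * m ^ n + x'` and
`y = b * m ^ n + y'` overflow a copy. -/
theorem carry_bound {a b s t : ℕ} (ha : 0 < a) :
    max (shift s a) (shift t b) + min a s + min b t ≤ a * b + a + b + min (a + b + 1) s := by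
  have h : b ≤ a * b := Nat.le_mul_of_pos_left b ha
  generalize a * b = ab at *
  unfold shift
  split <;> split <;> omega

/-- Two partially filled copies, the fuller one coming first, may be merged into the first one
when there is room. -/
theorem profile_merge {m n s t x y : ℕ} (hm : 0 < m) (hst : s ≤ t) (ht : t ≤ m) (hyx : y ≤ x)
    (hxy : x + y ≤ m ^ n) :
    profile m n s (x + y) ≤ profile m n s x + profile m n t y := by
  induction n generalizing s t x y with
  | zero =>
    have : y = 0 := by simp at hxy; omega
    simp [this, profile]
  | succ n ih =>
    have hM : 0 < m ^ n := Nat.pow_pos hm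
    have ih' := @profile_merge_full_of_merge m n hm ih
    rcases Nat.eq_zero_or_pos y with rfl | hy
    · simp [profile_zero_right]
    have hx : x < m ^ (n + 1) := by omega
    have ha : x / m ^ n < m := by
      rw [Nat.div_lt_iff_lt_mul hM, mul_comm, ← pow_succ]; exact hx
    have hba : y / m ^ n ≤ x / m ^ n := Nat.div_le_div_right hyx
    have hdx : m ^ n * (x / m ^ n) + x % m ^ n = x := Nat.div_add_mod x (m ^ n)
    have hdy : m ^ n * (y / m ^ n) + y % m ^ n = y := Nat.div_add_mod y (m ^ n)
    have hmx := Nat.mod_lt x hM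
    have hmy := Nat.mod_lt y hM
    generalize x / m ^ n = a at *
    generalize y / m ^ n = b at *
    generalize x % m ^ n = x' at *
    generalize y % m ^ n = y' at *
    have hpx := profile_succ (k := s) hm ha hmx.le
    have hpy := profile_succ (k := t) hm (hba.trans_lt ha) hmy.le
    rw [mul_comm, hdx] at hpx
    rw [mul_comm, hdy] at hpy
    rw [hpx, hpy]
    by_cases hc : x' + y' < m ^ n
    · have hab : a + b ≤ m := by
        by_contra h
        have : (m + 1) * m ^ n ≤ (a + b) * m ^ n := Nat.mul_le_mul_right _ (by omega)
        rw [pow_succ] at hxy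
        nlinarith
      have e : x + y = (a + b) * m ^ n + (x' + y') := by rw [← hdx, ← hdy]; ring
      rw [e, profile_succ_of_lt hc]
      rcases Nat.eq_zero_or_pos a with rfl | hapos
      · obtain rfl : b = 0 := by omega
        have := ih (s := shift s 0) (t := shift t 0) (x := x') (y := y')
          (by unfold shift; split <;> split <;> omega) (shift_le ha)
          (by simpa [← hdx, ← hdy] using hyx) hc.le
        simpa using this
      · have hr : shift s (a + b) ≤ m := shift_le_of_le (hst.trans ht) hab
        -- both profiles are bounded below by the one with threshold `shift s (a + b)`
        have h1 := profile_anti (n := n) (x := x') hm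
          (shift_mono (k := s) (Nat.le_add_right a b)) hr
        have h2 := profile_anti (n := n) (x := y') hm
          (show shift t b ≤ shift s (a + b) from
            le_trans (by unfold shift; split <;> omega) (le_shift s (a + b))) hr
        have h3 : profile m n (shift s (a + b)) (x' + y') ≤
            profile m n (shift s (a + b)) x' + profile m n (shift s (a + b)) y' := by
          rcases le_total y' x' with h | h
          · exact ih le_rfl hr h hc.le
          · have := ih (s := shift s (a + b)) le_rfl hr h (by omega)
            rw [add_comm y' x'] at this; linarith
        rw [sum_slope, sum_slope, sum_slope]
        have h4 : (min a s : ℤ) + min b t - min (a + b) s ≤ b := by omega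
        have h5 : (b : ℤ) ≤ a * b := by
          have : 1 * b ≤ a * b := Nat.mul_le_mul_right _ hapos
          exact_mod_cast (by omega : b ≤ a * b)
        push_cast at h4 ⊢
        nlinarith
    · push Not at hc
      have e : x + y = (a + b + 1) * m ^ n + (x' + y' - m ^ n) := by
        have : (a + b + 1) * m ^ n = m ^ n * a + m ^ n * b + m ^ n := by ring
        omega
      have hab : a + b + 1 ≤ m := by
        by_contra h
        have : (m + 1) * m ^ n ≤ (a + b + 1) * m ^ n := Nat.mul_le_mul_right _ (by omega)
        rw [pow_succ] at hxy
        nlinarith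
      have hr' : shift s (a + b + 1) ≤ m := shift_le_of_le (hst.trans ht) hab
      rw [e, profile_succ_of_lt (by omega)]
      rcases Nat.eq_zero_or_pos a with rfl | hapos
      · obtain rfl : b = 0 := by omega
        have h1 := ih' (s := shift s 0) (t := shift t 0) (x := x') (y := y')
          (by unfold shift; split <;> split <;> omega) (shift_le ha)
          (by simpa [← hdx, ← hdy] using hyx) hmx.le hc
        have h2 := profile_anti (n := n) (x := x' + y' - m ^ n) hm
          (show shift t 0 ≤ shift s 1 by unfold shift; split <;> split <;> omega) hr'
        simp only [Finset.sum_range_zero, Finset.sum_range_one, zero_add, add_zero] at *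
        linarith
      -- as in the case without overflow, with a single threshold `r` for both profiles
      · obtain ⟨r, hr⟩ : ∃ r, r = max (shift s a) (shift t b) := ⟨_, rfl⟩
        have hra : shift s a ≤ r := by omega
        have hrb : shift t b ≤ r := by omega
        have hrab : r ≤ a + b + 1 := by
          unfold shift at hr; split at hr <;> split at hr <;> omega
        have hrm : r ≤ m := hrab.trans hab
        have h1 := profile_anti (n := n) (x := x') hm hra hrm
        have h2 := profile_anti (n := n) (x := y') hm hrb hrm
        have h3 : (m : ℤ) - 2 * r + profile m n r (x' + y' - m ^ n) ≤
            profile m n r x' + profile m n r y' := by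
          rcases le_total y' x' with h | h
          · exact ih' le_rfl hrm h hmx.le hc
          · have := ih' (s := r) le_rfl hrm h hmy.le (by omega)
            rw [add_comm y' x'] at this; linarith
        have h4 := profile_anti (n := n) (x := x' + y' - m ^ n) hm
          (hrab.trans (le_shift s (a + b + 1))) hr'
        rw [sum_slope, sum_slope, sum_slope]
        have h5 : (r : ℤ) + min a s + min b t ≤ a * b + a + b + min (a + b + 1) s := by
          rw [hr]; exact_mod_cast carry_bound hapos
        push_cast at h5 ⊢
        linarith

/-- Two partially filled copies with more vertices than one copy holds, the fuller one coming
first: the first one may be filled up at the expense of the second one. -/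
theorem profile_merge_full {m n s t x y : ℕ} (hm : 0 < m) (hst : s ≤ t) (ht : t ≤ m) (hyx : y ≤ x)
    (hx : x ≤ m ^ n) (hxy : m ^ n ≤ x + y) :
    (m : ℤ) - 2 * s + profile m n t (x + y - m ^ n) ≤ profile m n s x + profile m n t y :=
  profile_merge_full_of_merge hm (fun hst ht hyx hxy => profile_merge hm hst ht hyx hxy)
    hst ht hyx hx hxy

/-! ### Distributing the vertices over the copies -/

theorem sum_change_two {A : Type*} [AddCommMonoid A] {s : Finset ℕ} {g g' : ℕ → A} {i j : ℕ}
    (hi : i ∈ s) (hj : j ∈ s) (hij : i ≠ j) (h : ∀ r, r ≠ i → r ≠ j → g r = g' r) :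
    ∑ r ∈ s, g r + (g' i + g' j) = ∑ r ∈ s, g' r + (g i + g j) := by
  have hj' : j ∈ s.erase i := Finset.mem_erase.2 ⟨hij.symm, hj⟩
  rw [← Finset.add_sum_erase s g hi, ← Finset.add_sum_erase s g' hi,
    ← Finset.add_sum_erase _ g hj', ← Finset.add_sum_erase _ g' hj',
    Finset.sum_congr rfl fun r hr => h r (Finset.ne_of_mem_erase (Finset.mem_of_mem_erase hr))
      (Finset.ne_of_mem_erase hr)]
  abel

/-- The inductive form of `profile_le_sum_shift`: the copies before `i` are full and those after
`i + d` are empty. The copies `i` and `i + d` are merged until `d` is zero. -/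
theorem profile_le_sum_shift_aux {m n k : ℕ} (hm : 0 < m) (d i : ℕ) (hd : i + d < m) (l : ℕ → ℕ)
    (hl : Antitone l) (hle : ∀ r, l r ≤ m ^ n) (hfull : ∀ r < i, l r = m ^ n)
    (hempty : ∀ r, i + d < r → l r = 0) :
    profile m (n + 1) k (∑ r ∈ Finset.range m, l r) ≤
      ∑ r ∈ Finset.range m, profile m n (shift k r) (l r) := by
  induction d generalizing i l with
  | zero =>
    rw [Finset.eventually_constant_sum (u := l) (N := i + 1) (fun r hr => hempty r hr) (by omega),
      Finset.eventually_constant_sum (u := fun r => profile m n (shift k r) (l r)) (N := i + 1)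
        (fun r hr => by simp [hempty r hr, profile_zero_right]) (by omega),
      Finset.sum_range_succ, Finset.sum_range_succ,
      Finset.sum_congr rfl fun r hr => hfull r (Finset.mem_range.1 hr), Finset.sum_const,
      Finset.card_range, smul_eq_mul, profile_succ hm (by omega) (hle i)]
    refine (add_le_add_left (Finset.sum_le_sum fun r hr => ?_) _)
    have hr' := Finset.mem_range.1 hr
    rw [hfull r hr', profile_full hm (shift_le (by omega))]
  | succ d ih =>
    have hji : l (i + (d + 1)) ≤ l i := hl (by omega)
    have hi := hle i
    have hst : shift k i ≤ shift k (i + (d + 1)) := shift_mono (by omega)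
    have ht : shift k (i + (d + 1)) ≤ m := shift_le hd
    -- it is enough to treat the distribution with `u` vertices in copy `i`, `v` in copy `i + d + 1`
    have key : ∀ u v : ℕ, u + v = l i + l (i + (d + 1)) →
        profile m n (shift k i) u + profile m n (shift k (i + (d + 1))) v ≤
          profile m n (shift k i) (l i) + profile m n (shift k (i + (d + 1))) (l (i + (d + 1))) →
        (∀ l' : ℕ → ℕ, l' i = u → l' (i + (d + 1)) = v →
          (∀ r, r ≠ i → r ≠ i + (d + 1) → l r = l' r) →
          profile m (n + 1) k (∑ r ∈ Finset.range m, l' r) ≤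
            ∑ r ∈ Finset.range m, profile m n (shift k r) (l' r)) →
        profile m (n + 1) k (∑ r ∈ Finset.range m, l r) ≤
          ∑ r ∈ Finset.range m, profile m n (shift k r) (l r) := by
      intro u v huv hle' H
      let l' : ℕ → ℕ := fun r => if r = i then u else if r = i + (d + 1) then v else l r
      have e1 : l' i = u := by simp [l']
      have e2 : l' (i + (d + 1)) = v := by simp [l']
      have e3 : ∀ r, r ≠ i → r ≠ i + (d + 1) → l r = l' r := by
        intro r h1 h2; simp [l', h1, h2]
      have h1 := H l' e1 e2 e3
      have hmem1 : i ∈ Finset.range m := Finset.mem_range.2 (by omega)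
      have hmem2 : i + (d + 1) ∈ Finset.range m := Finset.mem_range.2 (by omega)
      have h2 := sum_change_two (g := l) (g' := l') hmem1 hmem2 (by omega) e3
      have h3 := sum_change_two (g := fun r => profile m n (shift k r) (l r))
        (g' := fun r => profile m n (shift k r) (l' r)) hmem1 hmem2 (by omega)
        (fun r hr hr' => by rw [e3 r hr hr'])
      simp only [e1, e2] at h2 h3
      have h4 : ∑ r ∈ Finset.range m, l r = ∑ r ∈ Finset.range m, l' r := by omega
      rw [h4]
      linarith
    rcases le_total (l i + l (i + (d + 1))) (m ^ n) with h | h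
    · refine key (l i + l (i + (d + 1))) 0 rfl ?_ ?_
      · rw [profile_zero_right, add_zero]
        exact profile_merge hm hst ht hji h
      · intro l' e1 e2 e3
        have e0 : ∀ r, i + d < r → l' r = 0 := by
          intro r hr
          rcases eq_or_ne r (i + (d + 1)) with rfl | hr'
          · exact e2
          · rw [← e3 r (by omega) hr']; exact hempty r (by omega)
        refine ih i (by omega) l' (antitone_nat_of_succ_le fun r => ?_) (fun r => ?_)
          (fun r hr => ?_) e0
        · rcases eq_or_ne r i with rfl | h1
          · rcases Nat.eq_zero_or_pos d with rfl | hd'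
            · rw [e0 (r + 1) (by omega)]; exact Nat.zero_le _
            · rw [e1, ← e3 (r + 1) (by omega) (by omega)]
              exact (hl (Nat.le_succ r)).trans (Nat.le_add_right _ _)
          · rcases eq_or_ne (r + 1) i with h2 | h2
            · rw [h2, e1, ← e3 r h1 (by omega), hfull r (by omega)]; exact h
            · rcases lt_or_ge (i + d) (r + 1) with h3 | h3
              · rw [e0 _ h3]; exact Nat.zero_le _
              · rw [← e3 r h1 (by omega), ← e3 (r + 1) h2 (by omega)]
                exact hl (Nat.le_succ r)
        · rcases eq_or_ne r i with rfl | h1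
          · rw [e1]; exact h
          · rcases lt_or_ge (i + d) r with h3 | h3
            · rw [e0 _ h3]; exact Nat.zero_le _
            · rw [← e3 r h1 (by omega)]; exact hle r
        · rw [← e3 r (by omega) (by omega)]; exact hfull r hr
    · refine key (m ^ n) (l i + l (i + (d + 1)) - m ^ n) (by omega) ?_ ?_
      · rw [profile_full hm (hst.trans ht)]
        exact profile_merge_full hm hst ht hji hi h
      · intro l' e1 e2 e3
        have hv : l i + l (i + (d + 1)) - m ^ n ≤ l (i + (d + 1)) := by omega
        have e0 : ∀ r < i + 1, l' r = m ^ n := by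
          intro r hr
          rcases eq_or_ne r i with rfl | hr'
          · exact e1
          · rw [← e3 r hr' (by omega)]; exact hfull r (by omega)
        have e4 : ∀ r, l' r ≤ m ^ n := by
          intro r
          rcases lt_or_ge r (i + 1) with h1 | h1
          · exact (e0 r h1).le
          · rcases eq_or_ne r (i + (d + 1)) with rfl | h2
            · rw [e2]; exact hv.trans (hle _)
            · rw [← e3 r (by omega) h2]; exact hle r
        have e5 : ∀ r, i + (d + 1) < r → l' r = 0 := by
          intro r hr
          rw [← e3 r (by omega) (by omega)]; exact hempty r hr
        refine ih (i + 1) (by omega) l' (antitone_nat_of_succ_le fun r => ?_) e4 e0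
          (fun r hr => e5 r (by omega))
        rcases lt_or_ge r (i + 1) with h1 | h1
        · rw [e0 r h1]; exact e4 _
        · rcases eq_or_ne r (i + (d + 1)) with rfl | h2
          · rw [e5 _ (by omega)]; exact Nat.zero_le _
          · rcases eq_or_ne (r + 1) (i + (d + 1)) with h3 | h3
            · rw [h3, e2, ← e3 r (by omega) h2]
              exact hv.trans (hl (by omega))
            · rw [← e3 r (by omega) h2, ← e3 (r + 1) (by omega) h3]
              exact hl (Nat.le_succ r)

/-- If the copies hold `l 0 ≥ l 1 ≥ …` vertices and the `k` corners of class `I` sit at the first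
copies, then filling the copies one after the other is best. -/
theorem profile_le_sum_shift {m n k : ℕ} (hm : 0 < m) (l : ℕ → ℕ) (hl : Antitone l)
    (hle : ∀ r, l r ≤ m ^ n) (hempty : ∀ r, m ≤ r → l r = 0) :
    profile m (n + 1) k (∑ r ∈ Finset.range m, l r) ≤
      ∑ r ∈ Finset.range m, profile m n (shift k r) (l r) :=
  profile_le_sum_shift_aux hm (m - 1) 0 (by omega) l hl hle (fun _ h => absurd h (by omega))
    (fun r hr => hempty r (by omega))

/-- The corners of class `I` may be assumed to sit at the fullest copies: by
`profile_sub_profile_succ` the saving due to class `I` at copy `r` is antitone in `r`. -/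
theorem profile_le_sum {m n : ℕ} (hm : 0 < m) (l : ℕ → ℕ) (hl : Antitone l)
    (hle : ∀ r, l r ≤ m ^ n) (hempty : ∀ r, m ≤ r → l r = 0) (p : ℕ → Prop) [DecidablePred p] :
    profile m (n + 1) ((Finset.range m).filter p).card (∑ r ∈ Finset.range m, l r) ≤
      ∑ r ∈ Finset.range m, profile m n (if p r then r + 1 else r) (l r) := by
  refine (profile_le_sum_shift hm l hl hle hempty).trans ?_
  set k := ((Finset.range m).filter p).card with hk
  have hkm : k ≤ m := (Finset.card_filter_le _ _).trans (Finset.card_range m).le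
  let b : ℕ → ℤ := fun r => if cornerTime m n r ≤ l r then 2 else 0
  have hb : Antitone b := by
    intro r s hrs
    have h1 := cornerTime_mono m n hrs
    have h2 := hl hrs
    simp only [b]
    split <;> split <;> omega
  have key : ∀ q : ℕ → Prop, ∀ [DecidablePred q], ∀ r ∈ Finset.range m,
      profile m n (if q r then r + 1 else r) (l r) =
        profile m n r (l r) - (if q r then 1 else 0) * b r := by
    intro q _ r hr
    have := profile_sub_profile_succ (n := n) (x := l r) hm (Finset.mem_range.1 hr)
    simp only [b]
    rw [← this]
    split <;> ring
  have hsum :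
      ∑ r ∈ Finset.range m, ((if r < k then 1 else 0 : ℤ) - if p r then 1 else 0) = 0 := by
    rw [Finset.sum_sub_distrib, Finset.sum_boole, Finset.sum_boole, ← hk]
    have : (Finset.range m).filter (fun r => r < k) = Finset.range k := by
      ext r; simp; omega
    rw [this, Finset.card_range, sub_self]
  unfold shift
  rw [Finset.sum_congr rfl (key (fun r => r < k)), Finset.sum_congr rfl (key p)]
  rw [← sub_nonneg, ← Finset.sum_sub_distrib]
  have : ∑ r ∈ Finset.range m, ((if r < k then 1 else 0 : ℤ) - if p r then 1 else 0) * b k = 0 := by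
    rw [← Finset.sum_mul, hsum, zero_mul]
  refine this.symm.le.trans (Finset.sum_le_sum fun r _ => ?_)
  rcases lt_or_ge r k with h | h
  · have := hb h.le
    rw [if_pos h]
    split <;> linarith
  · have := hb h
    rw [if_neg (not_lt.2 h)]
    split <;> linarith

/-! ### Boundaries and the decomposition into copies -/

open Classical in
/-- The number of edges of `S(n,m)` leaving `S`, without exterior edges. -/
noncomputable def cutSize {n m : ℕ} (S : Finset (Fin n → Fin m)) : ℤ :=
  ∑ u, ∑ v, if (sierpinskiGraph n m).Adj u v ∧ u ∈ S ∧ v ∉ S then 1 else 0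

open Classical in
/-- The boundary functional for the corner classes `I` on the set `A` and `K` elsewhere: the
number of edges leaving `S`, plus one for each corner of class `K` in `S`, minus one for each
corner of class `I` in `S`. This is the size of the decorated boundary minus `A.card`. -/
noncomputable def boundaryExcess {n m : ℕ} (A : Finset (Fin m)) (S : Finset (Fin n → Fin m)) : ℤ :=
  cutSize S + ∑ j, (if j ∈ A then -1 else 1) * (if corner n j ∈ S then 1 else 0)

open Classical in
/-- The part of `S` in the `i`-th copy of `S(n,m)` in `S(n+1,m)`. -/
noncomputable def slice {n m : ℕ} (S : Finset (Fin (n + 1) → Fin m)) (i : Fin m) :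
    Finset (Fin n → Fin m) :=
  Finset.univ.filter fun v => (Fin.cons i v : Fin (n + 1) → Fin m) ∈ S

theorem mem_slice {n m : ℕ} {S : Finset (Fin (n + 1) → Fin m)} {i : Fin m} {v : Fin n → Fin m} :
    v ∈ slice S i ↔ (Fin.cons i v : Fin (n + 1) → Fin m) ∈ S := by
  simp [slice]

theorem sum_cons {n m : ℕ} {A : Type*} [AddCommMonoid A] (f : (Fin (n + 1) → Fin m) → A) :
    ∑ u, f u = ∑ i, ∑ v : Fin n → Fin m, f (Fin.cons i v) := by
  rw [← (Fin.consEquiv fun _ : Fin (n + 1) => Fin m).sum_comp, Fintype.sum_prod_type]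
  rfl

theorem sum_card_slice {n m : ℕ} (S : Finset (Fin (n + 1) → Fin m)) :
    ∑ i, (slice S i).card = S.card := by
  classical
  have h : S.card = ∑ u, if u ∈ S then 1 else 0 := by simp
  rw [h, sum_cons]
  exact Finset.sum_congr rfl fun i _ => by rw [slice, Finset.card_filter]

theorem corner_succ {n m : ℕ} (i : Fin m) : corner (n + 1) i = Fin.cons i (corner n i) := by
  funext j
  refine Fin.cases rfl (fun _ => rfl) j

theorem adj_cons_iff {n m : ℕ} {i j : Fin m} {u v : Fin n → Fin m} :
    (sierpinskiGraph (n + 1) m).Adj (Fin.cons i u) (Fin.cons j v) ↔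
      (j = i ∧ (sierpinskiGraph n m).Adj u v) ∨ (i ≠ j ∧ u = corner n j ∧ v = corner n i) := by
  constructor
  · rintro ⟨h, h1, h2, h3⟩
    induction h using Fin.cases with
    | zero =>
      refine Or.inr ⟨by simpa using h2, ?_, ?_⟩ <;> funext k
      · simpa [corner] using (h3 k.succ (Fin.succ_pos k)).1
      · simpa [corner] using (h3 k.succ (Fin.succ_pos k)).2
    | succ h =>
      refine Or.inl ⟨by simpa using (h1 0 (Fin.succ_pos h)).symm, h, fun k hk => ?_, ?_,
        fun k hk => ?_⟩
      · simpa using h1 k.succ (Fin.succ_lt_succ_iff.2 hk)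
      · simpa using h2
      · simpa using h3 k.succ (Fin.succ_lt_succ_iff.2 hk)
  · rintro (⟨rfl, h, h1, h2, h3⟩ | ⟨h, rfl, rfl⟩)
    · refine ⟨h.succ, fun k hk => ?_, by simpa using h2, fun k hk => ?_⟩
      · induction k using Fin.cases with
        | zero => rfl
        | succ k => simpa using h1 k (Fin.succ_lt_succ_iff.1 hk)
      · induction k using Fin.cases with
        | zero => exact absurd hk (Fin.not_lt_zero _)
        | succ k => simpa using h3 k (Fin.succ_lt_succ_iff.1 hk)
    · refine ⟨0, fun k hk => absurd hk (Fin.not_lt_zero _), by simpa using h, fun k hk => ?_⟩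
      induction k using Fin.cases with
      | zero => exact absurd hk (lt_irrefl _)
      | succ k => simp [corner]

open Classical in
/-- The edges leaving `S` lie in a copy, or they are one of the edges joining two copies. -/
theorem cutSize_succ {n m : ℕ} (S : Finset (Fin (n + 1) → Fin m)) :
    cutSize S = ∑ i, cutSize (slice S i) + ∑ i, ∑ j,
      if i ≠ j ∧ corner n j ∈ slice S i ∧ corner n i ∉ slice S j then 1 else 0 := by
  unfold cutSize
  rw [sum_cons, ← Finset.sum_add_distrib]
  refine Finset.sum_congr rfl fun i _ => ?_
  have h : ∀ u : Fin n → Fin m, (∑ w : Fin (n + 1) → Fin m,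
      if (sierpinskiGraph (n + 1) m).Adj (Fin.cons i u) w ∧ Fin.cons i u ∈ S ∧ w ∉ S
        then (1 : ℤ) else 0) =
      (∑ v, if (sierpinskiGraph n m).Adj u v ∧ u ∈ slice S i ∧ v ∉ slice S i then 1 else 0) +
      ∑ j, if u = corner n j then
        (if i ≠ j ∧ corner n j ∈ slice S i ∧ corner n i ∉ slice S j then 1 else 0) else 0 := by
    intro u
    rw [sum_cons]
    have h1 : ∀ (j : Fin m) (v : Fin n → Fin m),
        (if (sierpinskiGraph (n + 1) m).Adj (Fin.cons i u) (Fin.cons j v) ∧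
          (Fin.cons i u : Fin (n + 1) → Fin m) ∈ S ∧ (Fin.cons j v : Fin (n + 1) → Fin m) ∉ S
          then (1 : ℤ) else 0) =
        (if j = i then (if (sierpinskiGraph n m).Adj u v ∧ u ∈ slice S i ∧ v ∉ slice S i
          then 1 else 0) else 0) +
        (if v = corner n i then (if u = corner n j then
          (if i ≠ j ∧ corner n j ∈ slice S i ∧ corner n i ∉ slice S j then 1 else 0) else 0)
          else 0) := by
      intro j v
      rw [adj_cons_iff]
      simp only [mem_slice]
      by_cases h2 : j = i
      · subst h2; simp
      · have h3 : i ≠ j := Ne.symm h2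
        by_cases h4 : v = corner n i
        · by_cases h5 : u = corner n j
          · subst h4 h5; simp [h2, h3]
          · simp [h2, h5]
        · simp [h2, h4]
    simp only [h1, Finset.sum_add_distrib]
    congr 1
    · rw [Finset.sum_comm]
      simp
    · simp
  simp only [h, Finset.sum_add_distrib]
  congr 1
  rw [Finset.sum_comm]
  simp

/-- The corners of class `I` of the copy `i`, when the copies of lower rank `ρ` count as contained
in the set and those of higher rank as disjoint from it; the corner `i` of the copy is a corner
of the whole graph and keeps its class, which is `I` if `i ∈ A`. -/
def copyClass {m : ℕ} (ρ : Equiv.Perm (Fin m)) (A : Finset (Fin m)) (i : Fin m) :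
    Finset (Fin m) :=
  Finset.univ.filter fun j => ρ j < ρ i ∨ (j = i ∧ i ∈ A)

open Classical in
theorem sum_boundaryExcess_copyClass {n m : ℕ} (ρ : Equiv.Perm (Fin m)) (A : Finset (Fin m))
    (S : Finset (Fin (n + 1) → Fin m)) :
    ∑ i, boundaryExcess (copyClass ρ A i) (slice S i) = ∑ i, cutSize (slice S i) +
      ∑ i, ∑ j, (if i = j then 0 else if ρ i < ρ j then 1 else -1) *
        (if corner n j ∈ slice S i then (1 : ℤ) else 0) +
      ∑ j, (if j ∈ A then -1 else 1) * (if corner (n + 1) j ∈ S then 1 else 0) := by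
  unfold boundaryExcess
  rw [Finset.sum_add_distrib, add_assoc]
  congr 1
  rw [← Finset.sum_add_distrib]
  refine Finset.sum_congr rfl fun i _ => ?_
  have h : ∀ j : Fin m, (if j ∈ copyClass ρ A i then -1 else 1) *
        (if corner n j ∈ slice S i then (1 : ℤ) else 0) =
      (if i = j then 0 else if ρ i < ρ j then 1 else -1) *
        (if corner n j ∈ slice S i then (1 : ℤ) else 0) +
      (if i = j then (if i ∈ A then -1 else 1) *
        (if corner (n + 1) i ∈ S then 1 else 0) else 0) := by
    intro j
    by_cases hij : i = j
    · subst hij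
      simp [copyClass, mem_slice, corner_succ]
    · have h1 : ρ i ≠ ρ j := fun h => hij (ρ.injective h)
      have h2 : j ≠ i := Ne.symm hij
      rcases lt_or_gt_of_ne h1 with h3 | h3
      · simp [copyClass, hij, h2, h3, not_lt_of_gt h3]
      · simp [copyClass, hij, h3, not_lt_of_gt h3]
  simp only [h, Finset.sum_add_distrib]
  simp

theorem sum_sum_eq_of_add_eq {ι : Type*} [Fintype ι] {f g : ι → ι → ℤ}
    (h : ∀ i j, f i j + f j i = g i j + g j i) : ∑ i, ∑ j, f i j = ∑ i, ∑ j, g i j := by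
  have h1 : ∑ i, ∑ j, (f i j + f j i) = ∑ i, ∑ j, (g i j + g j i) :=
    Finset.sum_congr rfl fun i _ => Finset.sum_congr rfl fun j _ => h i j
  simp only [Finset.sum_add_distrib] at h1
  rw [Finset.sum_comm (f := fun i j => f j i), Finset.sum_comm (f := fun i j => g j i)] at h1
  linarith

theorem sum_sum_le_of_add_le {ι : Type*} [Fintype ι] {f g : ι → ι → ℤ}
    (h : ∀ i j, f i j + f j i ≤ g i j + g j i) : ∑ i, ∑ j, f i j ≤ ∑ i, ∑ j, g i j := by
  have h1 : ∑ i, ∑ j, (f i j + f j i) ≤ ∑ i, ∑ j, (g i j + g j i) :=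
    Finset.sum_le_sum fun i _ => Finset.sum_le_sum fun j _ => h i j
  simp only [Finset.sum_add_distrib] at h1
  rw [Finset.sum_comm (f := fun i j => f j i), Finset.sum_comm (f := fun i j => g j i)] at h1
  linarith

/-- Whatever the ranks, the copies decouple: the edge between the copies `i` and `j` contributes
`|x - y| ≥ x - y`, where `x` and `y` indicate whether its ends are in `S` and `x` belongs to the
copy of lower rank. -/
theorem sum_boundaryExcess_le {n m : ℕ} (ρ : Equiv.Perm (Fin m)) (A : Finset (Fin m))
    (S : Finset (Fin (n + 1) → Fin m)) :
    ∑ i, boundaryExcess (copyClass ρ A i) (slice S i) ≤ boundaryExcess A S := by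
  classical
  rw [sum_boundaryExcess_copyClass, boundaryExcess, cutSize_succ]
  refine add_le_add_left (add_le_add_right (sum_sum_le_of_add_le fun i j => ?_) _) _
  by_cases hij : i = j
  · subst hij; simp
  · have h1 : ρ i ≠ ρ j := fun h => hij (ρ.injective h)
    have h2 : j ≠ i := Ne.symm hij
    rcases lt_or_gt_of_ne h1 with h3 | h3 <;>
      by_cases h4 : corner n j ∈ slice S i <;> by_cases h5 : corner n i ∈ slice S j <;>
      simp [hij, h2, h3, h4, h5, not_lt_of_gt h3]

/-- The bound of `sum_boundaryExcess_le` is attained if no edge between two copies leaves `S`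
towards the copy of lower rank. -/
theorem sum_boundaryExcess_eq {n m : ℕ} (ρ : Equiv.Perm (Fin m)) (A : Finset (Fin m))
    (S : Finset (Fin (n + 1) → Fin m))
    (hS : ∀ i j, ρ i < ρ j → corner n i ∈ slice S j → corner n j ∈ slice S i) :
    ∑ i, boundaryExcess (copyClass ρ A i) (slice S i) = boundaryExcess A S := by
  classical
  rw [sum_boundaryExcess_copyClass, boundaryExcess, cutSize_succ]
  congr 2
  refine sum_sum_eq_of_add_eq fun i j => ?_
  by_cases hij : i = j
  · subst hij; simp
  · have h1 : ρ i ≠ ρ j := fun h => hij (ρ.injective h)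
    have h2 : j ≠ i := Ne.symm hij
    rcases lt_or_gt_of_ne h1 with h3 | h3
    · have := hS i j h3
      by_cases h4 : corner n j ∈ slice S i <;> by_cases h5 : corner n i ∈ slice S j <;>
        simp_all [not_lt_of_gt h3]
    · have := hS j i h3
      by_cases h4 : corner n j ∈ slice S i <;> by_cases h5 : corner n i ∈ slice S j <;>
        simp_all [not_lt_of_gt h3]

theorem boundaryExcess_empty {n m : ℕ} (A : Finset (Fin m)) :
    boundaryExcess A (∅ : Finset (Fin n → Fin m)) = 0 := by
  simp [boundaryExcess, cutSize]

theorem boundaryExcess_univ {n m : ℕ} (A : Finset (Fin m)) :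
    boundaryExcess A (Finset.univ : Finset (Fin n → Fin m)) = m - 2 * A.card := by
  have h : ∀ j : Fin m, (if j ∈ A then -1 else 1 : ℤ) = 1 - 2 * if j ∈ A then 1 else 0 := by
    intro j; split <;> norm_num
  simp [boundaryExcess, cutSize, h, mul_comm]

theorem card_filter_perm_lt {m k : ℕ} (ρ : Equiv.Perm (Fin m)) (hk : k ≤ m) :
    (Finset.univ.filter fun j => (ρ j : ℕ) < k).card = k := by
  have h : (Finset.univ.filter fun j => (ρ j : ℕ) < k).card =
      (Finset.univ.filter fun r : Fin m => (r : ℕ) < k).card :=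
    Finset.card_equiv ρ (by simp)
  rw [h, Fin.card_filter_val_lt, min_eq_right hk]

theorem card_copyClass {m : ℕ} (ρ : Equiv.Perm (Fin m)) (A : Finset (Fin m)) (i : Fin m) :
    (copyClass ρ A i).card = if i ∈ A then (ρ i : ℕ) + 1 else ρ i := by
  split
  · rename_i h
    rw [← card_filter_perm_lt ρ (k := ρ i + 1) (ρ i).isLt]
    congr 1
    ext j
    simp only [copyClass, h, and_true, Finset.mem_filter, Finset.mem_univ, true_and,
      Nat.lt_succ_iff_lt_or_eq, Fin.lt_def, Fin.val_inj, ρ.injective.eq_iff]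
  · rename_i h
    rw [← card_filter_perm_lt ρ (k := ρ i) (ρ i).isLt.le]
    congr 1
    ext j
    simp [copyClass, h]

/-- The profile is a lower bound. The induction ranks the copies by decreasing number of vertices
of `S`, so that `profile_le_sum` applies to the decoupled sum. -/
theorem profile_le_boundaryExcess {n m : ℕ} (hm : 0 < m) (A : Finset (Fin m))
    (S : Finset (Fin n → Fin m)) : profile m n A.card S.card ≤ boundaryExcess A S := by
  classical
  induction n generalizing A with
  | zero =>
    rcases S.eq_empty_or_nonempty with rfl | hS
    · simp [boundaryExcess_empty, profile]
    · have : S = Finset.univ := Finset.eq_univ_of_forall fun u => by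
        obtain ⟨v, hv⟩ := hS; rwa [Subsingleton.elim u v]
      subst this
      rw [boundaryExcess_univ]
      simp [profile]
  | succ n ih =>
    let f : Fin m → ℕᵒᵈ := fun i => OrderDual.toDual (slice S i).card
    let ρ : Equiv.Perm (Fin m) := (Tuple.sort f).symm
    have hρ : ∀ r s : Fin m, r ≤ s → (slice S (ρ.symm s)).card ≤ (slice S (ρ.symm r)).card :=
      fun r s hrs => Tuple.monotone_sort f hrs
    let l : ℕ → ℕ := fun r => if h : r < m then (slice S (ρ.symm ⟨r, h⟩)).card else 0
    have hl : Antitone l := by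
      intro r s hrs
      simp only [l]
      split
      · rw [dif_pos (by omega)]
        exact hρ _ _ hrs
      · exact Nat.zero_le _
    have hle : ∀ r, l r ≤ m ^ n := by
      intro r
      simp only [l]
      split
      · exact (Finset.card_le_univ _).trans (by simp)
      · exact Nat.zero_le _
    let p : ℕ → Prop := fun r => ∃ h : r < m, ρ.symm ⟨r, h⟩ ∈ A
    have hl' : ∀ r : Fin m, l r = (slice S (ρ.symm r)).card := fun r => dif_pos r.isLt
    have hp' : ∀ r : Fin m, p r ↔ ρ.symm r ∈ A :=
      fun r => ⟨fun ⟨_, h⟩ => h, fun h => ⟨r.isLt, h⟩⟩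
    have h := profile_le_sum (n := n) hm l hl hle (fun r hr => dif_neg (by omega)) p
    have h1 : ∑ r ∈ Finset.range m, l r = S.card := by
      rw [Finset.sum_range, ← sum_card_slice,
        ← Equiv.sum_comp ρ.symm fun i => (slice S i).card]
      exact Finset.sum_congr rfl fun r _ => hl' r
    have h2 : ((Finset.range m).filter p).card = A.card := by
      rw [Finset.card_filter, Finset.sum_range, ← Equiv.sum_comp ρ]
      simp
    rw [h1, h2, Finset.sum_range, ← Equiv.sum_comp ρ] at h
    refine h.trans (le_trans (Finset.sum_le_sum fun i _ => ?_) (sum_boundaryExcess_le ρ A S))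
    have h3 := ih (copyClass ρ A i) (slice S i)
    rw [card_copyClass] at h3
    simpa only [hl', hp', Equiv.symm_apply_apply] using h3

/-! ### The lexicographic order attains the profile -/

/-- The position of a vertex in the lexicographic order of the vertices of `S(n,m)`, the symbols
being ordered by their rank `ρ`. -/
def lexCode {m : ℕ} (ρ : Equiv.Perm (Fin m)) : (n : ℕ) → (Fin n → Fin m) → ℕ
  | 0, _ => 0
  | n + 1, u => ρ (u 0) * m ^ n + lexCode ρ n (Fin.tail u)

theorem lexCode_cons {m n : ℕ} (ρ : Equiv.Perm (Fin m)) (i : Fin m) (v : Fin n → Fin m) :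
    lexCode ρ (n + 1) (Fin.cons i v) = ρ i * m ^ n + lexCode ρ n v := rfl

theorem lexCode_lt {m n : ℕ} (ρ : Equiv.Perm (Fin m)) (u : Fin n → Fin m) :
    lexCode ρ n u < m ^ n := by
  induction n with
  | zero => simp [lexCode]
  | succ n ih =>
    have h1 := ih (Fin.tail u)
    have h2 : ((ρ (u 0) : ℕ) + 1) * m ^ n ≤ m * m ^ n := Nat.mul_le_mul_right _ (ρ (u 0)).isLt
    simp only [lexCode, pow_succ]
    nlinarith

theorem lexCode_injective {m n : ℕ} (ρ : Equiv.Perm (Fin m)) :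
    Function.Injective (lexCode ρ n) := by
  induction n with
  | zero => intro u v _; exact Subsingleton.elim u v
  | succ n ih =>
    intro u v h
    have hu := lexCode_lt ρ (Fin.tail u)
    have hv := lexCode_lt ρ (Fin.tail v)
    simp only [lexCode] at h
    have h1 : (ρ (u 0) : ℕ) = ρ (v 0) := by
      have := congrArg (· / m ^ n) h
      simpa [mul_comm _ (m ^ n), Nat.mul_add_div (Nat.zero_lt_of_lt hu), Nat.div_eq_of_lt hu,
        Nat.div_eq_of_lt hv] using this
    have h2 : u 0 = v 0 := ρ.injective (Fin.ext h1)
    have h3 : Fin.tail u = Fin.tail v := ih (by rw [h1] at h; omega)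
    rw [← Fin.cons_self_tail u, ← Fin.cons_self_tail v, h2, h3]

/-- The first `x` vertices in the lexicographic order. -/
def lexSegment {m : ℕ} (ρ : Equiv.Perm (Fin m)) (n x : ℕ) : Finset (Fin n → Fin m) :=
  Finset.univ.filter fun u => lexCode ρ n u < x

theorem lexSegment_full {m : ℕ} (ρ : Equiv.Perm (Fin m)) {n x : ℕ} (hx : m ^ n ≤ x) :
    lexSegment ρ n x = Finset.univ :=
  Finset.filter_true_of_mem fun u _ => (lexCode_lt ρ u).trans_le hx

theorem lexSegment_zero {m : ℕ} (ρ : Equiv.Perm (Fin m)) (n : ℕ) : lexSegment ρ n 0 = ∅ := by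
  simp [lexSegment]

/-- A lexicographic segment fills the copies one after the other. -/
theorem slice_lexSegment {m n a y : ℕ} (ρ : Equiv.Perm (Fin m)) (hy : y < m ^ n) (i : Fin m) :
    slice (lexSegment ρ (n + 1) (a * m ^ n + y)) i =
      if (ρ i : ℕ) < a then Finset.univ else if (ρ i : ℕ) = a then lexSegment ρ n y else ∅ := by
  ext v
  rw [mem_slice]
  simp only [lexSegment, Finset.mem_filter, Finset.mem_univ, true_and, lexCode_cons]
  have hv := lexCode_lt ρ v
  rcases lt_trichotomy (ρ i : ℕ) a with h | h | h
  · have h1 : ((ρ i : ℕ) + 1) * m ^ n ≤ a * m ^ n := Nat.mul_le_mul_right _ h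
    rw [if_pos h]
    simp only [Finset.mem_univ, iff_true]
    nlinarith
  · rw [if_neg (by omega), if_pos h, h]
    simp
  · have h1 : (a + 1) * m ^ n ≤ (ρ i : ℕ) * m ^ n := Nat.mul_le_mul_right _ h
    rw [if_neg (by omega), if_neg (by omega)]
    simp only [Finset.notMem_empty, iff_false]
    nlinarith

theorem copyClass_filter_lt {m : ℕ} (ρ : Equiv.Perm (Fin m)) (k : ℕ) (i : Fin m) :
    copyClass ρ (Finset.univ.filter fun j => (ρ j : ℕ) < k) i =
      Finset.univ.filter fun j => (ρ j : ℕ) < shift k (ρ i) := by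
  ext j
  have h : j = i ↔ (ρ j : ℕ) = ρ i := by rw [Fin.val_inj, ρ.injective.eq_iff]
  simp only [copyClass, Finset.mem_filter, Finset.mem_univ, true_and, Fin.lt_def, h]
  unfold shift
  split <;> omega

/-- Lexicographic segments attain the profile, whatever the number `k` of corners of class `I`,
provided that these are the `k` corners of lowest rank. -/
theorem boundaryExcess_lexSegment {m n k x : ℕ} (hm : 0 < m) (ρ : Equiv.Perm (Fin m)) (hk : k ≤ m)
    (hx : x ≤ m ^ n) :
    boundaryExcess (Finset.univ.filter fun j => (ρ j : ℕ) < k) (lexSegment ρ n x) =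
      profile m n k x := by
  induction n generalizing k x with
  | zero =>
    have : x = 0 ∨ x = m ^ 0 := by simp at hx ⊢; omega
    rcases this with rfl | rfl
    · rw [lexSegment_zero, boundaryExcess_empty, profile_zero_right]
    · rw [lexSegment_full ρ le_rfl, boundaryExcess_univ, card_filter_perm_lt ρ hk,
        profile_full hm hk]
  | succ n ih =>
    have hM : 0 < m ^ n := Nat.pow_pos hm
    rcases hx.lt_or_eq with hx | rfl
    · have hdiv : x / m ^ n * m ^ n + x % m ^ n = x := by
        rw [mul_comm]; exact Nat.div_add_mod x (m ^ n)
      have hmod := Nat.mod_lt x hM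
      have ha : x / m ^ n < m := by
        rw [Nat.div_lt_iff_lt_mul hM, mul_comm, ← pow_succ]; exact hx
      generalize x / m ^ n = a at *
      generalize x % m ^ n = y at *
      rw [← hdiv, profile_succ_of_lt hmod, ← sum_boundaryExcess_eq ρ]
      · let F : ℕ → ℤ := fun r => if r < a then (m : ℤ) - 2 * shift k r
          else if r = a then profile m n (shift k a) y else 0
        have h : ∀ i : Fin m, boundaryExcess
            (copyClass ρ (Finset.univ.filter fun j => (ρ j : ℕ) < k) i)
            (slice (lexSegment ρ (n + 1) (a * m ^ n + y)) i) = F (ρ i) := by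
          intro i
          simp only [F]
          rw [copyClass_filter_lt, slice_lexSegment ρ hmod]
          split
          · rw [boundaryExcess_univ, card_filter_perm_lt ρ (shift_le (ρ i).isLt)]
          · split
            · rename_i h
              rw [ih (shift_le (ρ i).isLt) hmod.le, h]
            · exact boundaryExcess_empty _
        rw [Finset.sum_congr rfl fun i _ => h i, Equiv.sum_comp ρ fun r : Fin m => F r,
          ← Finset.sum_range F, Finset.eventually_constant_sum (u := F) (N := a + 1) _ (by omega),
          Finset.sum_range_succ]
        · congr 1
          · exact Finset.sum_congr rfl fun r hr => if_pos (Finset.mem_range.1 hr)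
          · simp [F]
        · intro r hr
          simp only [F]
          rw [if_neg (by omega), if_neg (by omega)]
      · intro i j hij
        rw [Fin.lt_def] at hij
        rw [slice_lexSegment ρ hmod, slice_lexSegment ρ hmod]
        by_cases h1 : (ρ i : ℕ) < a
        · simp [h1]
        · rw [if_neg (by omega), if_neg (by omega)]
          simp
    · rw [lexSegment_full ρ le_rfl, boundaryExcess_univ, card_filter_perm_lt ρ hk,
        profile_full hm hk]

/-! ### Decorated boundaries -/

open Classical in
theorem ncard_edgeBoundary {V : Type*} [Fintype V] (G : SimpleGraph V) (W : Set V) :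
    (edgeBoundary G W).ncard = ∑ x, ∑ y, if G.Adj x y ∧ x ∈ W ∧ y ∉ W then 1 else 0 := by
  let D : Finset (V × V) := Finset.univ.filter fun q => G.Adj q.1 q.2 ∧ q.1 ∈ W ∧ q.2 ∉ W
  have h : edgeBoundary G W = (fun q : V × V => s(q.1, q.2)) '' (D : Set (V × V)) := by
    ext e
    constructor
    · rintro ⟨he, v, w, rfl, hv, hw⟩
      exact ⟨(v, w), by simpa [D] using ⟨he, hv, hw⟩, rfl⟩
    · rintro ⟨⟨v, w⟩, hq, rfl⟩
      simp only [D, Finset.coe_filter, Finset.mem_univ, true_and, Set.mem_ofPred_eq] at hq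
      exact ⟨hq.1, v, w, rfl, hq.2.1, hq.2.2⟩
  rw [h, Set.InjOn.ncard_image, Set.ncard_coe_finset, Finset.card_filter,
    Fintype.sum_prod_type]
  rintro ⟨v, w⟩ h1 ⟨v', w'⟩ h2 h3
  simp only [D, Finset.coe_filter, Finset.mem_univ, true_and, Set.mem_ofPred_eq] at h1 h2
  rcases Sym2.eq_iff.1 h3 with ⟨rfl, rfl⟩ | ⟨rfl, rfl⟩
  · rfl
  · exact absurd h1.2.1 h2.2.2

open Classical in
theorem decoratedBoundarySize_eq {n m : ℕ} (c : Fin m → CornerClass)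
    (S : Finset (Fin n → Fin m)) :
    (decoratedBoundarySize n c S : ℤ) = cutSize S +
      ∑ i, (if c i = CornerClass.K ∧ corner n i ∈ S then 1 else 0) +
      ∑ i, (if c i = CornerClass.I ∧ corner n i ∉ S then 1 else 0) := by
  have hl : ∀ u : Fin n → Fin m,
      (Sum.inl u : (Fin n → Fin m) ⊕ ExteriorVertex c) ∈ withExterior n c S ↔ u ∈ S := by
    intro u; simp [withExterior]
  have hr : ∀ i : ExteriorVertex c,
      (Sum.inr i : (Fin n → Fin m) ⊕ ExteriorVertex c) ∈ withExterior n c S ↔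
        c i.1 = CornerClass.I := by
    intro i
    constructor
    · rintro (⟨u, _, h⟩ | ⟨j, hj, h⟩)
      · exact absurd h Sum.inr_ne_inl
      · rwa [Sum.inr_injective h]
    · exact fun h => Or.inr ⟨i, h, rfl⟩
  have hsub : ∀ f : Fin m → ℤ, ∑ i : ExteriorVertex c, f i.1 =
      ∑ i, if c i ≠ CornerClass.J then f i else 0 := by
    intro f
    rw [← Finset.sum_filter]
    exact (Finset.sum_subtype _ (by simp) f).symm
  have all : ∀ u v : Fin n → Fin m,
      (decoratedSierpinskiGraph n c).Adj (Sum.inl u) (Sum.inl v) ↔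
        (sierpinskiGraph n m).Adj u v := fun _ _ => Iff.rfl
  have alr : ∀ (u : Fin n → Fin m) (i : ExteriorVertex c),
      (decoratedSierpinskiGraph n c).Adj (Sum.inl u) (Sum.inr i) ↔ u = corner n i.1 :=
    fun _ _ => Iff.rfl
  have arl : ∀ (u : Fin n → Fin m) (i : ExteriorVertex c),
      (decoratedSierpinskiGraph n c).Adj (Sum.inr i) (Sum.inl u) ↔ u = corner n i.1 :=
    fun _ _ => Iff.rfl
  have arr : ∀ i j : ExteriorVertex c,
      (decoratedSierpinskiGraph n c).Adj (Sum.inr i) (Sum.inr j) ↔ False := fun _ _ => Iff.rfl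
  have hK : (∑ u : Fin n → Fin m, ∑ i : ExteriorVertex c,
      if u = corner n i.1 ∧ u ∈ S ∧ ¬ c i.1 = CornerClass.I then (1 : ℤ) else 0) =
      ∑ i, if c i = CornerClass.K ∧ corner n i ∈ S then 1 else 0 := by
    rw [Finset.sum_comm]
    simp only [ite_and, Finset.sum_ite_eq', Finset.mem_univ, if_true]
    rw [hsub fun i => if corner n i ∈ S then (if ¬ c i = CornerClass.I then 1 else 0) else 0]
    refine Finset.sum_congr rfl fun i _ => ?_
    cases h : c i <;> simp
  have hI : (∑ i : ExteriorVertex c, ∑ u : Fin n → Fin m,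
      if u = corner n i.1 ∧ c i.1 = CornerClass.I ∧ u ∉ S then (1 : ℤ) else 0) =
      ∑ i, if c i = CornerClass.I ∧ corner n i ∉ S then 1 else 0 := by
    simp only [ite_and, Finset.sum_ite_eq', Finset.mem_univ, if_true]
    rw [hsub fun i => if c i = CornerClass.I then (if ¬ corner n i ∈ S then 1 else 0) else 0]
    refine Finset.sum_congr rfl fun i _ => ?_
    cases h : c i <;> simp
  rw [decoratedBoundarySize, ncard_edgeBoundary]
  push_cast
  simp only [Fintype.sum_sum_type, hl, hr, all, alr, arl, arr, Finset.sum_add_distrib, false_and,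
    if_false, Finset.sum_const_zero, add_zero]
  rw [hK, hI, cutSize]
  ring

open Classical in
/-- A corner without exterior edge is the mean of a corner of class `I` and one of class `K`. -/
theorem two_mul_decoratedBoundarySize {n m : ℕ} (c : Fin m → CornerClass)
    (S : Finset (Fin n → Fin m)) :
    2 * (decoratedBoundarySize n c S : ℤ) =
      2 * (Finset.univ.filter fun i => c i = CornerClass.I).card +
        boundaryExcess (Finset.univ.filter fun i => c i = CornerClass.I) S +
        boundaryExcess (Finset.univ.filter fun i => c i ≠ CornerClass.K) S := by
  rw [decoratedBoundarySize_eq, boundaryExcess, boundaryExcess, Finset.card_filter]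
  push_cast
  have h : ∑ i, (2 * (if c i = CornerClass.K ∧ corner n i ∈ S then (1 : ℤ) else 0) +
      2 * (if c i = CornerClass.I ∧ corner n i ∉ S then 1 else 0)) =
      ∑ i, (2 * (if c i = CornerClass.I then 1 else 0) +
        (if i ∈ (Finset.univ.filter fun i => c i = CornerClass.I) then -1 else 1) *
          (if corner n i ∈ S then 1 else 0) +
        (if i ∈ (Finset.univ.filter fun i => c i ≠ CornerClass.K) then -1 else 1) *
          (if corner n i ∈ S then 1 else 0)) := by
    refine Finset.sum_congr rfl fun i _ => ?_
    by_cases hS : corner n i ∈ S <;> cases hc : c i <;> simp [hS, hc]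
  simp only [Finset.sum_add_distrib, ← Finset.mul_sum] at h
  linarith

/-- A set of symbols that is closed under passing to lower ranks is determined by its size. -/
theorem filter_eq_filter_lt_card {m : ℕ} (ρ : Equiv.Perm (Fin m)) (p : Fin m → Prop)
    [DecidablePred p] (hp : ∀ i j, ρ i ≤ ρ j → p j → p i) :
    Finset.univ.filter p =
      Finset.univ.filter fun j => (ρ j : ℕ) < (Finset.univ.filter p).card := by
  ext j
  simp only [Finset.mem_filter, Finset.mem_univ, true_and]
  constructor
  · intro hj
    rw [← Nat.succ_le_iff, ← card_filter_perm_lt ρ (ρ j).isLt]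
    refine Finset.card_le_card fun i hi => ?_
    simp only [Finset.mem_filter, Finset.mem_univ, true_and, Nat.lt_succ_iff] at hi ⊢
    exact hp i j hi hj
  · intro hj
    by_contra hn
    refine absurd hj (not_lt.2 ?_)
    rw [← card_filter_perm_lt ρ (ρ j).isLt.le]
    refine Finset.card_le_card fun i hi => ?_
    simp only [Finset.mem_filter, Finset.mem_univ, true_and] at hi ⊢
    by_contra h
    exact hn (hp j i (not_lt.1 h) hi)

/-- The order of the symbols in an optimal numbering: class `I`, then `J`, then `K`. -/
def CornerClass.level : CornerClass → ℕ
  | I => 0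
  | J => 1
  | K => 2

theorem decoratedBoundarySize_lexSegment_le {n m x : ℕ} (hm : 0 < m) (c : Fin m → CornerClass)
    (ρ : Equiv.Perm (Fin m)) (hρ : ∀ i j, ρ i ≤ ρ j → (c i).level ≤ (c j).level)
    (hx : x ≤ m ^ n) (T : Finset (Fin n → Fin m)) (hT : T.card = x) :
    decoratedBoundarySize n c (lexSegment ρ n x) ≤ decoratedBoundarySize n c T := by
  classical
  have key : ∀ p : Fin m → Prop, ∀ [DecidablePred p], (∀ i j, ρ i ≤ ρ j → p j → p i) →
      boundaryExcess (Finset.univ.filter p) (lexSegment ρ n x) ≤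
        boundaryExcess (Finset.univ.filter p) T := by
    intro p _ hp
    have h1 := profile_le_boundaryExcess hm (Finset.univ.filter p) T
    have h2 := boundaryExcess_lexSegment hm ρ
      ((Finset.card_le_univ (Finset.univ.filter p)).trans (Fintype.card_fin m).le) hx
    rw [← filter_eq_filter_lt_card ρ p hp] at h2
    rw [h2, ← hT]
    exact h1
  have h1 := key (fun i => c i = CornerClass.I) fun i j hij h => by
    have := hρ i j hij
    revert this h
    cases c i <;> cases c j <;> simp [CornerClass.level]
  have h2 := key (fun i => c i ≠ CornerClass.K) fun i j hij h => by
    have := hρ i j hij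
    revert this h
    cases c i <;> cases c j <;> simp [CornerClass.level]
  have h3 := two_mul_decoratedBoundarySize c (lexSegment ρ n x)
  have h4 := two_mul_decoratedBoundarySize c T
  have h5 : (decoratedBoundarySize n c (lexSegment ρ n x) : ℤ) ≤ decoratedBoundarySize n c T := by
    linarith
  exact_mod_cast h5

theorem mainTheorem4 (n m : ℕ) (hn : 1 ≤ n) (hm : 2 ≤ m) (c : Fin m → CornerClass) :
    HasNestedSolutions (decoratedBoundarySize n c) := by
  let f : Fin m → ℕ := fun i => (c i).level
  let ρ : Equiv.Perm (Fin m) := (Tuple.sort f).symm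
  have hρ : ∀ i j, ρ i ≤ ρ j → (c i).level ≤ (c j).level := by
    intro i j hij
    have := Tuple.monotone_sort f hij
    simpa [ρ, f] using this
  have hcard : Fintype.card (Fin n → Fin m) = m ^ n := by simp
  let e : (Fin n → Fin m) ≃ Fin (Fintype.card (Fin n → Fin m)) :=
    Equiv.ofBijective (fun u => ⟨lexCode ρ n u, hcard.symm ▸ lexCode_lt ρ u⟩)
      ((Fintype.bijective_iff_injective_and_card _).2
        ⟨fun u v h => lexCode_injective ρ (congrArg Fin.val h), (Fintype.card_fin _).symm⟩)
  have he : ∀ u, (e u : ℕ) = lexCode ρ n u := fun _ => rfl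
  refine ⟨e.symm, fun l hl => ?_⟩
  have hS : (Finset.univ.filter fun k : Fin (Fintype.card (Fin n → Fin m)) => (k : ℕ) < l).map
      e.symm.toEmbedding = lexSegment ρ n l := by
    ext u
    simp [lexSegment, Finset.mem_map_equiv, he]
  refine ⟨?_, fun T hT => ?_⟩
  · rw [Finset.card_map, Fin.card_filter_val_lt, min_eq_right hl]
  · rw [hS]
    exact decoratedBoundarySize_lexSegment_le (by omega) c ρ hρ (hcard ▸ hl) T hT
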